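/- Let $\mathbb{K}$ be $\mathbb{R}$ or $\mathbb{C}$, let $q,r,\mu,\nu$ be positive integers, and let $z\in\mathbb{K}$. Matrix and block indices start at $0$, and $A^{(k)}$ denotes the $k$-th (entrywise) derivative of $A$ with respect to $z$. Let $u(z)=(1,z,\ldots,z^{q-1})^\top$, $w(z)=(1,z,\ldots,z^{r-1})$ and $M(z)=u(z)w(z)\in\mathbb{K}^{q\times r}$. Let $\mathcal{N}(z)$ be the $\mu q\times\nu r$ matrix with the $q\times r$ blocks $$\mathcal{N}^{ij}(z)=\frac{1}{i!\,j!}M^{(i+j)}(z),\qquad 0\le i\le\mu-1,\ 0\le j\le\nu-1.$$ For $n\ge 0$ let $S_n$ be the $n\times n$ shift matrix with entries $\delta_{i+1,j}$. For $k\ge 0$ let $F_k(z)$ be the matrix of size $\max(r-k,0)\times\max(r-k-1,0)$ with entries $-z$ for $i=j$, $1$ for $i=j+1$, and $0$ otherwise. Let $G(z)$ be the $r\times r$ matrix with entries $z^{j-i-1}$ for $j>i$ and $0$ otherwise, and let $G_{k0}(z)$ consist of its first $\max(r-k,0)$ rows. Put $\nu_*=q+r-1$, so that $\nu_*-q=r-1$.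 Let $\ell_q$ be the last standard basis vector of $\mathbb{K}^q$ and $\mathrm{f}_{r-1}$ the first standard basis vector of $\mathbb{K}^{r-1}$. For $k\ge0$ put $$\bar K_k(z)=\begin{pmatrix} I_q\otimes F_k(z)+S_q\otimes F_k'(z) & -\ell_q\mathrm{f}_{r-1}^\top\otimes\frac{1}{k!}G_{k0}^{(k)}(z)\\ 0 & I_{r-1}\otimes I_r-S_{r-1}\otimes G(z)\end{pmatrix}$$ (blocks with no rows or no columns are empty), and let $$\bar{\mathcal{K}}_*^{\mu-1}(z)=\bar K_0(z)\bar K_1(z)\cdots\bar K_{\mu-1}(z),$$ a matrix of size $\nu_*r\times(\nu_*r-q\min\{\mu,r\})$. Theorem. Let $\nu\ge q+r$. Then $\ker\mathcal{N}(z)\subseteq\mathbb{K}^{\nu r}$ is spanned by the columns of the block diagonal matrix $$\begin{pmatrix}\bar{\mathcal{K}}_*^{\mu-1}(z) & 0\\ 0 & I_{r(\nu-q-r+1)}\end{pmatrix}.$$ It has dimension $\nu r-\mu q$ if $\mu<r$ and dimension $(\nu-q)r$ if $\mu\ge r$; that is, $\dim\ker\mathcal{N}(z)=\nu r-q\min\{\mu,r\}$.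 -/

import Mathlib

open scoped Kronecker

noncomputable section

namespace ConfluentVandermonde

variable {𝕜 : Type*} [RCLike 𝕜]

/-- Entrywise `k`-th derivative of a matrix valued function, evaluated at `z`. -/
def matDeriv {m n : Type*} (k : ℕ) (A : 𝕜 → Matrix m n 𝕜) (z : 𝕜) : Matrix m n 𝕜 :=
  Matrix.of fun i j => iteratedDeriv k (fun t => A t i j) z

/-- The column `u(z) = (1, z, …, z^(q-1))ᵀ`. -/
def u (q : ℕ) (z : 𝕜) : Fin q → 𝕜 := fun i => z ^ (i : ℕ)

/-- The row `w(z) = (1, z, …, z^(r-1))`. -/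
def w (r : ℕ) (z : 𝕜) : Fin r → 𝕜 := fun j => z ^ (j : ℕ)

/-- `M(z) = u(z) w(z)`, of size `q × r`. -/
def M (q r : ℕ) (z : 𝕜) : Matrix (Fin q) (Fin r) 𝕜 := Matrix.vecMulVec (u q z) (w r z)

/-- The `μ q × ν r` matrix `𝒩(z)` whose `(i, j)` block is `M^(i+j)(z) / (i! j!)`. A row (column)
index is a pair (block, position inside the block). -/
def calN (q r μ ν : ℕ) (z : 𝕜) : Matrix (Fin μ × Fin q) (Fin ν × Fin r) 𝕜 :=
  Matrix.of fun a b =>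
    (((a.1 : ℕ).factorial : 𝕜) * ((b.1 : ℕ).factorial : 𝕜))⁻¹ *
      matDeriv ((a.1 : ℕ) + (b.1 : ℕ)) (M q r) z a.2 b.2

/-- The shift matrix `S_n`, with entries `δ_{i+1,j}`. -/
def shift (n : ℕ) : Matrix (Fin n) (Fin n) 𝕜 :=
  Matrix.of fun i j => if (i : ℕ) + 1 = (j : ℕ) then 1 else 0

/-- `F_k(z)`, of size `(r-k) × (r-k-1)`: `-z` on the diagonal, `1` just below the diagonal,
and `0` elsewhere. It has no columns for `k ≥ r - 1`, and no rows either for `k ≥ r`. -/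
def F (r k : ℕ) (z : 𝕜) : Matrix (Fin (r - k)) (Fin (r - (k + 1))) 𝕜 :=
  Matrix.of fun i j =>
    if (i : ℕ) = (j : ℕ) then -z else if (i : ℕ) = (j : ℕ) + 1 then 1 else 0

/-- `G(z)`, of size `r × r`, with entries `z^(j-i-1)` for `j > i` and `0` elsewhere. -/
def G (r : ℕ) (z : 𝕜) : Matrix (Fin r) (Fin r) 𝕜 :=
  Matrix.of fun i j => if (i : ℕ) < (j : ℕ) then z ^ ((j : ℕ) - (i : ℕ) - 1) else 0

/-- `G_{k0}(z)`, the first `r - k` rows of `G(z)`. -/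
def Gtop (r k : ℕ) (z : 𝕜) : Matrix (Fin (r - k)) (Fin r) 𝕜 :=
  (G r z).submatrix (Fin.castLE (Nat.sub_le r k)) id

/-- The matrix `ℓ_m f_nᵀ`, with `ℓ_m` the last standard basis vector of `𝕜^m` and `f_n` the first
one of `𝕜^n`: its single nonzero entry is a `1` in the lower left corner. -/
def corner (m n : ℕ) : Matrix (Fin m) (Fin n) 𝕜 :=
  Matrix.of fun a b => if (a : ℕ) + 1 = m ∧ (b : ℕ) = 0 then 1 else 0

/-- The factor `K̄_k(z)`, for every `k ≥ 0`:
`[[I_q ⊗ F_k + S_q ⊗ F_k', -(ℓ_q f_{ν-q}ᵀ) ⊗ (1/k!) G_{k0}^(k)], [0, I_{ν-q} ⊗ I_r - S_{ν-q} ⊗ G]]`.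
For `k ≥ r - 1` the first block column is empty and the upper right block is zero (`k = r - 1`)
or has no rows (`k ≥ r`). -/
def barK (q r ν k : ℕ) (z : 𝕜) :
    Matrix (Fin q × Fin (r - k) ⊕ Fin (ν - q) × Fin r)
      (Fin q × Fin (r - (k + 1)) ⊕ Fin (ν - q) × Fin r) 𝕜 :=
  Matrix.fromBlocks
    ((1 : Matrix (Fin q) (Fin q) 𝕜) ⊗ₖ F r k z + shift q ⊗ₖ matDeriv 1 (F r k) z)
    (-(corner q (ν - q) ⊗ₖ ((k.factorial : 𝕜)⁻¹ • matDeriv k (Gtop r k) z)))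
    0
    ((1 : Matrix (Fin (ν - q)) (Fin (ν - q)) 𝕜) ⊗ₖ (1 : Matrix (Fin r) (Fin r) 𝕜)
      - shift (ν - q) ⊗ₖ G r z)

/-- The product `K̄_0(z) K̄_1(z) ⋯ K̄_i(z)`. -/
def barCalK (q r ν : ℕ) : (i : ℕ) → (z : 𝕜) →
    Matrix (Fin q × Fin r ⊕ Fin (ν - q) × Fin r)
      (Fin q × Fin (r - (i + 1)) ⊕ Fin (ν - q) × Fin r) 𝕜
  | 0, z => barK q r ν 0 z
  | i + 1, z => barCalK q r ν i z * barK q r ν (i + 1) z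

/-- The order preserving splitting of `n` blocks of size `r` into the first `m` and the last
`n - m` blocks. -/
def splitBlocks {m n : ℕ} (h : m ≤ n) (r : ℕ) :
    Fin n × Fin r ≃ Fin m × Fin r ⊕ Fin (n - m) × Fin r :=
  (Equiv.prodCongrLeft fun _ : Fin r =>
      (finCongr (Nat.add_sub_cancel' h).symm).trans finSumFinEquiv.symm).trans
    (Equiv.sumProdDistrib _ _ _)

/-- `𝒦̄_*^i(z)`: the matrix `K̄_0(z) ⋯ K̄_i(z)` for `ν = q + r - 1`, its rows being indexed by
(block, position inside the block). -/
def barCalKStar (q r i : ℕ) (hr : 0 < r) (z : 𝕜) :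
    Matrix (Fin (q + r - 1) × Fin r)
      (Fin q × Fin (r - (i + 1)) ⊕ Fin (q + r - 1 - q) × Fin r) 𝕜 :=
  (barCalK q r (q + r - 1) i z).submatrix
    (splitBlocks (show q ≤ q + r - 1 by omega) r) id

/-- The block diagonal matrix `diag(𝒦̄_*^i(z), I)`, where `I` is the identity matrix of order
`r (ν - (q + r - 1))`; it has `ν r` rows. -/
def barBarCalK (q r ν i : ℕ) (hr : 0 < r) (hν : q + r ≤ ν) (z : 𝕜) :
    Matrix (Fin ν × Fin r)
      ((Fin q × Fin (r - (i + 1)) ⊕ Fin (q + r - 1 - q) × Fin r) ⊕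
        Fin (ν - (q + r - 1)) × Fin r) 𝕜 :=
  (Matrix.fromBlocks (barCalKStar q r i hr z) 0 0 1).submatrix
    (splitBlocks (show q + r - 1 ≤ ν by omega) r) id

end ConfluentVandermonde

end

/-! Read each block of a vector `v` as a polynomial `V j` of degree less than `r`, and let `H m` be
the `m`-th Hasse derivative. The entries of `calN` applied to `v` are Taylor coefficients at `z` of
the sums `∑ j, H j (X ^ a * V j)`. By the Leibniz rule, `v` lies in the kernel iff `(X - C z) ^ μ`
divides `W l = ∑ m, H m (V (l + m))` for all `l < q` (`mem_ker_calN_iff`).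

The operation `V j ↦ (X - C z) * V j - V (j + 1)` multiplies every `W l` by `X - C z`, since the
Leibniz terms telescope. Each factor `barK` performs this operation, up to constants at positions `j
≥ q` that no `W l` with `l < q` sees (`seqPoly_barK_mulVec`). Hence `μ` factors produce kernel
vectors. Blocks from position `q + r - 1` on enter these `W l` only through derivatives of order at
least `r`, so they are free; this explains the identity block.

The generators are independent because each factor is triangular and `X - C z` is not a zero
divisor. A kernel vector is determined by its blocks from `q` on and the Taylor coefficients of
orders `μ, …, r - 1` of the `W l`, which bounds the kernel dimension by the number of generators. -/

namespace ConfluentVandermonde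

open Polynomial

/-! ### Blocks as polynomials, division by `X - C z`, and Hasse sums. -/

section PolynomialPart

variable {K : Type*} [Field K]

open scoped Classical in
/-- The polynomial with coefficient vector `v`. -/
noncomputable def rowPoly (n : ℕ) : (Fin n → K) →ₗ[K] K[X] := ofFn n

theorem rowPoly_coeff {n : ℕ} (v : Fin n → K) (i : ℕ) :
    (rowPoly n v).coeff i = if h : i < n then v ⟨i, h⟩ else 0 := by
  classical
  unfold rowPoly
  split_ifs with h
  · exact ofFn_coeff_eq_val_of_lt v h
  · exact ofFn_coeff_eq_zero_of_ge v (not_lt.mp h)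

theorem rowPoly_eq_sum {n : ℕ} (v : Fin n → K) :
    rowPoly n v = ∑ i : Fin n, v i • X ^ (i : ℕ) := by
  classical
  simp only [rowPoly, ofFn_eq_sum_monomial, smul_X_eq_monomial]

theorem rowPoly_injective (n : ℕ) : Function.Injective (rowPoly (K := K) n) := by
  classical
  exact injective_ofFn n

/-- The polynomial formed by the `j`-th block of `x`, and zero beyond the last block. -/
noncomputable def blockPoly (n s j : ℕ) : (Fin n × Fin s → K) →ₗ[K] K[X] :=
  if h : j < n then rowPoly s ∘ₗ LinearMap.funLeft K K (fun i => (⟨j, h⟩, i)) else 0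

theorem blockPoly_of_lt {n s j : ℕ} (h : j < n) (x : Fin n × Fin s → K) :
    blockPoly n s j x = rowPoly s (fun i => x (⟨j, h⟩, i)) := by
  simp only [blockPoly, dif_pos h]
  rfl

theorem blockPoly_of_le {n s j : ℕ} (h : n ≤ j) (x : Fin n × Fin s → K) :
    blockPoly n s j x = 0 := by
  simp [blockPoly, dif_neg (not_lt.mpr h)]

theorem blockPoly_coeff_of_le {n s j i : ℕ} (h : s ≤ i) (x : Fin n × Fin s → K) :
    (blockPoly n s j x).coeff i = 0 := by
  rcases lt_or_ge j n with hj | hj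
  · rw [blockPoly_of_lt hj, rowPoly_coeff, dif_neg (not_lt.mpr h)]
  · rw [blockPoly_of_le hj, coeff_zero]

theorem eq_zero_of_blockPoly_eq_zero {n s : ℕ} {x : Fin n × Fin s → K}
    (h : ∀ j < n, blockPoly n s j x = 0) : x = 0 := by
  ext ⟨a, i⟩
  have h1 := h a a.2
  rw [blockPoly_of_lt a.2, ← map_zero (rowPoly s)] at h1
  exact congrFun (rowPoly_injective s h1) i

/-- Division by `X - z`, discarding the remainder. -/
noncomputable def divXSubC (z : K) : K[X] →ₗ[K] K[X] where
  toFun f := f /ₘ (X - C z)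
  map_add' f g := by
    apply mul_left_cancel₀ (X_sub_C_ne_zero z)
    simp only [mul_add, X_sub_C_mul_divByMonic_eq_sub_modByMonic, modByMonic_X_sub_C_eq_C_eval,
      eval_add, C_add]
    ring
  map_smul' c f := by
    apply mul_left_cancel₀ (X_sub_C_ne_zero z)
    simp only [RingHom.id_apply, mul_smul_comm, X_sub_C_mul_divByMonic_eq_sub_modByMonic,
      modByMonic_X_sub_C_eq_C_eval, eval_smul, smul_sub, smul_eq_mul, smul_C]

theorem X_sub_C_mul_divXSubC (z : K) (f : K[X]) :
    (X - C z) * divXSubC z f = f - C (f.eval z) := by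
  rw [← modByMonic_X_sub_C_eq_C_eval]
  exact X_sub_C_mul_divByMonic_eq_sub_modByMonic f z

theorem divXSubC_eq_of_mul_eq {z c : K} {f g : K[X]} (h : (X - C z) * g = f - C c) :
    divXSubC z f = g := by
  have hc : f.eval z = c := by
    have := congrArg (eval z) h
    exact sub_eq_zero.mp (by simpa using this.symm)
  apply mul_left_cancel₀ (X_sub_C_ne_zero z)
  rw [X_sub_C_mul_divXSubC, h, hc]

/-- The `k`-th Hasse derivative in `z` of the entry of `G(z)` in row `i` and column `j`. -/
def quotCoeff (z : K) (k i j : ℕ) : K :=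
  if i < j then ((j - i - 1).choose k : K) * z ^ (j - i - 1 - k) else 0

theorem quotCoeff_zero_rec (z : K) (i j : ℕ) :
    quotCoeff z 0 i j = (if i + 1 = j then 1 else 0) + z * quotCoeff z 0 (i + 1) j := by
  unfold quotCoeff
  rcases lt_trichotomy (i + 1) j with h | h | h
  · obtain ⟨d, rfl⟩ := Nat.exists_eq_add_of_lt h
    rw [if_pos (by omega), if_neg (by omega), if_pos h, show i + 1 + d + 1 - i - 1 = d + 1 by omega,
      show i + 1 + d + 1 - (i + 1) - 1 = d by omega]
    simp [pow_succ, mul_comm]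
  · subst h
    simp
  · rw [if_neg (by omega), if_neg (by omega), if_neg (by omega)]
    simp

theorem quotCoeff_succ_rec (z : K) (k i j : ℕ) :
    quotCoeff z (k + 1) i j = quotCoeff z k (i + 1) j + z * quotCoeff z (k + 1) (i + 1) j := by
  unfold quotCoeff
  rcases lt_trichotomy (i + 1) j with h | h | h
  · obtain ⟨d, rfl⟩ := Nat.exists_eq_add_of_lt h
    rw [if_pos (by omega), if_pos h, if_pos h, show i + 1 + d + 1 - i - 1 = d + 1 by omega,
      show i + 1 + d + 1 - (i + 1) - 1 = d by omega, Nat.choose_succ_succ, Nat.add_sub_add_right]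
    rcases lt_or_ge k d with hd | hd
    · rw [show d - k = d - (k + 1) + 1 by omega]
      push_cast
      ring
    · rw [Nat.choose_eq_zero_of_lt (show d < k + 1 by omega)]
      simp
  · subst h
    simp
  · rw [if_neg (by omega), if_neg (by omega), if_neg (by omega)]
    simp

/-- The hypothesis is Horner's recurrence for synthetic division; continued one step below degree 0
it yields the remainder. -/
theorem divXSubC_eq_of_coeff_rec {z : K} {f g : K[X]}
    (h : ∀ i, g.coeff i = f.coeff (i + 1) + z * g.coeff (i + 1)) : divXSubC z f = g := by
  apply divXSubC_eq_of_mul_eq (c := f.coeff 0 + z * g.coeff 0)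
  ext i
  rcases i with _ | i
  · simp [sub_mul]
  · simp [sub_mul, coeff_X_mul, h i]

theorem sum_quotCoeff_coeff (z : K) (k i j : ℕ) :
    (∑ m ∈ Finset.range j, C (quotCoeff z k m j) * X ^ m).coeff i = quotCoeff z k i j := by
  simp only [finsetSum_coeff, coeff_C_mul_X_pow, Finset.sum_ite_eq, Finset.mem_range]
  split_ifs with h
  · rfl
  · simp [quotCoeff, h]

/-- Links derivatives of `G` in `z` with repeated division: by Pascal's rule, one more division
raises by one the order of the Hasse derivative in `z` of the quotient's coefficients. -/
theorem divXSubC_iterate_X_pow (z : K) (k j : ℕ) :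
    (divXSubC z)^[k + 1] (X ^ j) = ∑ m ∈ Finset.range j, C (quotCoeff z k m j) * X ^ m := by
  induction k with
  | zero =>
    apply divXSubC_eq_of_coeff_rec
    intro i
    rw [sum_quotCoeff_coeff, sum_quotCoeff_coeff, coeff_X_pow, quotCoeff_zero_rec]
  | succ k ih =>
    rw [Function.iterate_succ_apply', ih]
    apply divXSubC_eq_of_coeff_rec
    intro i
    rw [sum_quotCoeff_coeff, sum_quotCoeff_coeff, sum_quotCoeff_coeff, quotCoeff_succ_rec]

theorem divXSubC_iterate_map_sum_smul {ι : Type*} (z : K) (k : ℕ) (s : Finset ι) (c : ι → K)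
    (f : ι → K[X]) :
    (divXSubC z)^[k] (∑ i ∈ s, c i • f i) = ∑ i ∈ s, c i • (divXSubC z)^[k] (f i) := by
  simp only [← Module.End.pow_apply, map_sum, map_smul]

theorem divXSubC_iterate_rowPoly_coeff {n : ℕ} (z : K) (k i : ℕ) (v : Fin n → K) :
    ((divXSubC z)^[k + 1] (rowPoly n v)).coeff i = ∑ j : Fin n, quotCoeff z k i j * v j := by
  rw [rowPoly_eq_sum, divXSubC_iterate_map_sum_smul, finsetSum_coeff]
  refine Finset.sum_congr rfl fun j _ => ?_
  rw [divXSubC_iterate_X_pow, coeff_smul, sum_quotCoeff_coeff, smul_eq_mul, mul_comm]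

/-- The sum of the Hasse derivatives of orders `m < N` of the terms `V (l + m)`. -/
noncomputable def hasseSum (N : ℕ) (V : ℕ → K[X]) (l : ℕ) : K[X] :=
  ∑ m ∈ Finset.range N, hasseDeriv m (V (l + m))

theorem hasseDeriv_succ_X_mul (m : ℕ) (f : K[X]) :
    hasseDeriv (m + 1) (X * f) = X * hasseDeriv (m + 1) f + hasseDeriv m f := by
  ext i
  rcases i with _ | i
  · simp [hasseDeriv_coeff, coeff_X_mul, ← add_assoc]
  · rw [hasseDeriv_coeff, coeff_add, coeff_X_mul, hasseDeriv_coeff, hasseDeriv_coeff,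
      show i + 1 + (m + 1) = (i + (m + 1)) + 1 by ring, coeff_X_mul,
      show i + 1 + m = i + (m + 1) by ring, Nat.choose_succ_succ (i + (m + 1)) m]
    push_cast
    ring

theorem hasseDeriv_succ_X_sub_C_mul (z : K) (m : ℕ) (f : K[X]) :
    hasseDeriv (m + 1) ((X - C z) * f) = (X - C z) * hasseDeriv (m + 1) f + hasseDeriv m f := by
  rw [sub_mul, map_sub, hasseDeriv_succ_X_mul, ← smul_eq_C_mul, map_smul, smul_eq_C_mul]
  ring

/-- By Leibniz, `H (m + 1)` of `(X - C z) * V` leaves an extra `H m V`; these extras form exactly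
the Hasse sum of the shifted sequence, which is subtracted. The vanishing of `V` from `N` on removes
the boundary term. -/
theorem hasseSum_X_sub_C_mul_sub_shift (z : K) {N : ℕ} {V : ℕ → K[X]} (hV : ∀ j, N ≤ j → V j = 0)
    (l : ℕ) :
    hasseSum N (fun j => (X - C z) * V j - V (j + 1)) l = (X - C z) * hasseSum N V l := by
  unfold hasseSum
  rcases N with _ | N
  · simp
  have h1 : ∑ m ∈ Finset.range (N + 1), hasseDeriv m ((X - C z) * V (l + m)) =
      (X - C z) * ∑ m ∈ Finset.range (N + 1), hasseDeriv m (V (l + m)) +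
        ∑ m ∈ Finset.range N, hasseDeriv m (V (l + m + 1)) := by
    rw [Finset.sum_range_succ', Finset.sum_range_succ' (fun m => hasseDeriv m (V (l + m)))]
    simp only [hasseDeriv_succ_X_sub_C_mul, Finset.sum_add_distrib, ← Finset.mul_sum, mul_add,
      hasseDeriv_zero', add_assoc]
    ring
  simp only [map_sub, Finset.sum_sub_distrib]
  rw [h1, Finset.sum_range_succ (fun m => hasseDeriv m (V (l + m + 1))), hV (l + N + 1) (by omega)]
  simp

theorem hasseSum_add (N : ℕ) (V W : ℕ → K[X]) (l : ℕ) :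
    hasseSum N (fun j => V j + W j) l = hasseSum N V l + hasseSum N W l := by
  simp only [hasseSum, map_add, Finset.sum_add_distrib]

/-- Derivatives of positive order kill constants, so only the undifferentiated term at `l` could
contribute. This makes the remainders discarded by division harmless. -/
theorem hasseSum_C (N : ℕ) (c : ℕ → K) {l : ℕ} (hl : c l = 0) :
    hasseSum N (fun j => C (c j)) l = 0 := by
  refine Finset.sum_eq_zero fun m _ => ?_
  rcases m with _ | m
  · simp [hl]
  · exact hasseDeriv_C _ _ m.succ_pos

/-- The system is unitriangular: the sum at `l` is `V l` plus terms in later `V`, so it is solved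
from `q - 1` downwards. -/
theorem eq_zero_of_hasseSum_eq_zero {N : ℕ} {V : ℕ → K[X]} {q : ℕ} (hN : 0 < N)
    (hV : ∀ j, q ≤ j → V j = 0) (h : ∀ l < q, hasseSum N V l = 0) (j : ℕ) : V j = 0 := by
  rcases lt_or_ge j q with hj | hj
  · obtain ⟨d, hd⟩ : ∃ d, q - j = d := ⟨_, rfl⟩
    induction d using Nat.strong_induction_on generalizing j with
    | _ d ih =>
      have h0 := h j hj
      rw [hasseSum, Finset.sum_eq_single 0] at h0
      · simpa using h0
      · intro m _ hm
        rcases lt_or_ge (j + m) q with hjm | hjm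
        · rw [ih (q - (j + m)) (by omega) (j + m) hjm rfl, map_zero]
        · rw [hV _ hjm, map_zero]
      · exact fun h' => absurd (Finset.mem_range.mpr hN) h'
  · exact hV j hj

/-- If `V` vanishes from `N` on, divisibility of the sums `∑ H_j (X ^ a * V j)` for `a < q` is the
same as divisibility of the first `q` Hasse sums. -/
theorem forall_dvd_sum_hasseDeriv_iff (p : K[X]) (N q : ℕ) (V : ℕ → K[X])
    (hV : ∀ j, N ≤ j → V j = 0) :
    (∀ a < q, p ∣ ∑ j ∈ Finset.range N, hasseDeriv j (X ^ a * V j)) ↔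
      ∀ l < q, p ∣ hasseSum N V l := by
  induction q generalizing V with
  | zero => simp
  | succ q ih =>
    -- An extra factor `X` amounts, by Leibniz, to multiplying the sum by `X` and adding the same
    -- sum for the shifted sequence.
    have hstep : ∀ a, ∑ j ∈ Finset.range N, hasseDeriv j (X ^ (a + 1) * V j) =
        X * ∑ j ∈ Finset.range N, hasseDeriv j (X ^ a * V j) +
          ∑ j ∈ Finset.range N, hasseDeriv j (X ^ a * V (j + 1)) := by
      intro a
      rcases N with _ | N
      · simp
      rw [Finset.sum_range_succ', Finset.sum_range_succ' (fun j => hasseDeriv j (X ^ a * V j)),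
        Finset.sum_range_succ (fun j => hasseDeriv j (X ^ a * V (j + 1))), hV (N + 1) le_rfl]
      simp only [pow_succ', mul_assoc, hasseDeriv_succ_X_mul, Finset.sum_add_distrib,
        ← Finset.mul_sum, hasseDeriv_zero', mul_zero, map_zero, mul_add]
      ring
    have hshift := ih (fun j => V (j + 1)) (fun j hj => hV _ (by omega))
    have hW : ∀ l, hasseSum N (fun j => V (j + 1)) l = hasseSum N V (l + 1) := fun l =>
      Finset.sum_congr rfl fun m _ => by
        rw [show l + 1 + m = l + m + 1 by ring]
    have h0 : ∑ j ∈ Finset.range N, hasseDeriv j (X ^ 0 * V j) = hasseSum N V 0 := by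
      simp [hasseSum]
    simp only [hW] at hshift
    constructor
    · intro h l hl
      rcases l with _ | l
      · rw [← h0]; exact h 0 hl
      · refine hshift.mp (fun a ha => ?_) l (by omega)
        have h1 := h (a + 1) (by omega)
        rw [hstep] at h1
        exact (dvd_add_right (Dvd.dvd.mul_left (h a (by omega)) X)).mp h1
    · intro h a
      induction a with
      | zero => intro ha; rw [h0]; exact h 0 ha
      | succ a iha =>
        intro ha
        rw [hstep]
        exact dvd_add (Dvd.dvd.mul_left (iha (by omega)) X)
          (hshift.mpr (fun l hl => h (l + 1) (by omega)) a (by omega))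

theorem X_sub_C_pow_dvd_iff_hasseDeriv (z : K) (n : ℕ) (p : K[X]) :
    (X - C z) ^ n ∣ p ↔ ∀ i < n, (hasseDeriv i p).eval z = 0 := by
  rw [X_sub_C_pow_dvd_iff, X_pow_dvd_iff]
  simp only [← taylor_coeff, taylor_apply]

end PolynomialPart

end ConfluentVandermonde

namespace ConfluentVandermonde

open Polynomial Matrix

/-! ### The matrices as operators on polynomials. -/

section MatrixPart

variable {𝕜 : Type*} [RCLike 𝕜]

theorem blockPoly_kronecker_mulVec {m n s s' : ℕ} (B : Matrix (Fin m) (Fin n) 𝕜)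
    (A : Matrix (Fin s') (Fin s) 𝕜) {j : ℕ} (h : j < m) (x : Fin n × Fin s → 𝕜) :
    blockPoly m s' j ((B ⊗ₖ A) *ᵥ x) =
      ∑ b : Fin n, B ⟨j, h⟩ b • rowPoly s' (A *ᵥ fun i => x (b, i)) := by
  rw [blockPoly_of_lt h]
  simp only [← map_smul, ← map_sum]
  congr 1
  ext i
  simp only [mulVec, dotProduct, Fintype.sum_prod_type, kroneckerMap_apply, Finset.sum_apply,
    Pi.smul_apply, smul_eq_mul, Finset.mul_sum, mul_assoc]

theorem blockPoly_one_kronecker_mulVec {n s s' : ℕ} {A : Matrix (Fin s') (Fin s) 𝕜}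
    {L : 𝕜[X] →ₗ[𝕜] 𝕜[X]} (hL : ∀ v, rowPoly s' (A *ᵥ v) = L (rowPoly s v)) (j : ℕ)
    (x : Fin n × Fin s → 𝕜) :
    blockPoly n s' j (((1 : Matrix (Fin n) (Fin n) 𝕜) ⊗ₖ A) *ᵥ x) = L (blockPoly n s j x) := by
  rcases lt_or_ge j n with h | h
  · rw [blockPoly_kronecker_mulVec _ _ h, blockPoly_of_lt h, ← hL, Finset.sum_eq_single ⟨j, h⟩]
    · simp
    · intro b _ hb
      rw [Matrix.one_apply_ne hb.symm, zero_smul]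
    · simp
  · rw [blockPoly_of_le h, blockPoly_of_le h, map_zero]

theorem blockPoly_shift_kronecker_mulVec {n s s' : ℕ} {A : Matrix (Fin s') (Fin s) 𝕜}
    {L : 𝕜[X] →ₗ[𝕜] 𝕜[X]} (hL : ∀ v, rowPoly s' (A *ᵥ v) = L (rowPoly s v)) (j : ℕ)
    (x : Fin n × Fin s → 𝕜) :
    blockPoly n s' j ((shift (𝕜 := 𝕜) n ⊗ₖ A) *ᵥ x) = L (blockPoly n s (j + 1) x) := by
  rcases lt_or_ge j n with h | h
  · rw [blockPoly_kronecker_mulVec _ _ h]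
    rcases lt_or_ge (j + 1) n with h1 | h1
    · rw [blockPoly_of_lt h1, ← hL, Finset.sum_eq_single ⟨j + 1, h1⟩]
      · simp [shift]
      · intro b _ hb
        have : ¬ (j + 1 = (b : ℕ)) := fun hb' => hb (Fin.ext hb'.symm)
        simp [shift, this]
      · simp
    · rw [blockPoly_of_le h1, map_zero]
      refine Finset.sum_eq_zero fun b _ => ?_
      have : ¬ (j + 1 = (b : ℕ)) := by omega
      simp [shift, this]
  · rw [blockPoly_of_le h, blockPoly_of_le (by omega), map_zero]

theorem blockPoly_corner_kronecker_mulVec {m n s s' : ℕ} {A : Matrix (Fin s') (Fin s) 𝕜}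
    {L : 𝕜[X] →ₗ[𝕜] 𝕜[X]} (hL : ∀ v, rowPoly s' (A *ᵥ v) = L (rowPoly s v)) {j : ℕ} (h : j < m)
    (x : Fin n × Fin s → 𝕜) :
    blockPoly m s' j ((corner (𝕜 := 𝕜) m n ⊗ₖ A) *ᵥ x) =
      if j + 1 = m then L (blockPoly n s 0 x) else 0 := by
  rw [blockPoly_kronecker_mulVec _ _ h]
  split_ifs with hj
  · rcases Nat.eq_zero_or_pos n with rfl | hn
    · simp [blockPoly_of_le]
    rw [blockPoly_of_lt hn, ← hL, Finset.sum_eq_single ⟨0, hn⟩]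
    · simp [corner, hj]
    · intro b _ hb
      have : ¬ ((b : ℕ) = 0) := fun hb' => hb (Fin.ext hb')
      simp [corner, this]
    · simp
  · refine Finset.sum_eq_zero fun b _ => ?_
    simp [corner, hj]

theorem rowPoly_F_mulVec (r k : ℕ) (z : 𝕜) (v : Fin (r - (k + 1)) → 𝕜) :
    rowPoly (r - k) (F r k z *ᵥ v) = (X - C z) * rowPoly (r - (k + 1)) v := by
  ext i
  have hF : ∀ (i : ℕ) (j : Fin (r - (k + 1))), (if i = (j : ℕ) then -z
      else if i = (j : ℕ) + 1 then 1 else 0) * v j =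
      (if i = (j : ℕ) then -z * v j else 0) + (if i = (j : ℕ) + 1 then v j else 0) := by
    intro i j
    split_ifs <;> first | omega | simp
  have h1 : ∀ i : ℕ, ∑ j : Fin (r - (k + 1)), (if i = (j : ℕ) then -z * v j else 0) =
      -z * (rowPoly _ v).coeff i := by
    intro i
    rw [rowPoly_coeff]
    split_ifs with h
    · rw [Finset.sum_eq_single ⟨i, h⟩]
      · simp
      · intro b _ hb
        exact if_neg fun hb' => hb (Fin.ext hb'.symm)
      · simp
    · rw [mul_zero]
      exact Finset.sum_eq_zero fun b _ => if_neg (by omega)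
  have h2 : ∀ i : ℕ, ∑ j : Fin (r - (k + 1)), (if i = (j : ℕ) + 1 then v j else 0) =
      (X * rowPoly _ v).coeff i := by
    intro i
    rcases i with _ | i
    · simp
    rw [coeff_X_mul, rowPoly_coeff]
    split_ifs with h
    · rw [Finset.sum_eq_single ⟨i, h⟩]
      · simp
      · intro b _ hb
        exact if_neg fun hb' => hb (Fin.ext (by simpa using hb'.symm))
      · simp
    · exact Finset.sum_eq_zero fun b _ => if_neg (by omega)
  have h3 : ((X - C z) * rowPoly (r - (k + 1)) v).coeff i =
      ∑ j : Fin (r - (k + 1)), (if i = (j : ℕ) then -z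
        else if i = (j : ℕ) + 1 then 1 else 0) * v j := by
    simp only [hF, Finset.sum_add_distrib, h1, h2, sub_mul, coeff_sub, coeff_C_mul]
    ring
  rw [h3, rowPoly_coeff]
  split_ifs with h
  · simp [mulVec, dotProduct, F]
  · refine (Finset.sum_eq_zero fun j _ => ?_).symm
    rw [if_neg (by omega), if_neg (by omega), zero_mul]

theorem matDeriv_one_F_apply (r k : ℕ) (z : 𝕜) (i : Fin (r - k)) (j : Fin (r - (k + 1))) :
    matDeriv 1 (F r k) z i j = if (i : ℕ) = (j : ℕ) then -1 else 0 := by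
  simp only [matDeriv, F, of_apply, iteratedDeriv_one]
  split_ifs <;> simp

theorem rowPoly_matDeriv_F_mulVec (r k : ℕ) (z : 𝕜) (v : Fin (r - (k + 1)) → 𝕜) :
    rowPoly (r - k) (matDeriv 1 (F r k) z *ᵥ v) = -rowPoly (r - (k + 1)) v := by
  ext i
  rw [coeff_neg, rowPoly_coeff, rowPoly_coeff]
  split_ifs with h h' h'
  · simp only [mulVec, dotProduct, matDeriv_one_F_apply]
    rw [Finset.sum_eq_single ⟨i, h'⟩]
    · simp
    · intro b _ hb
      rw [if_neg fun hb' => hb (Fin.ext hb'.symm), zero_mul]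
    · simp
  · simp only [mulVec, dotProduct, matDeriv_one_F_apply]
    rw [Finset.sum_eq_zero, neg_zero]
    intro b _
    rw [if_neg (by omega), zero_mul]
  · omega
  · simp

theorem eval_hasseDeriv_X_pow (z : 𝕜) (k n : ℕ) :
    (hasseDeriv k (X ^ n)).eval z = (n.choose k : 𝕜) * z ^ (n - k) := by
  rw [← monomial_one_right_eq_X_pow, hasseDeriv_monomial, eval_monomial, mul_one]

theorem iteratedDeriv_pow_eq_factorial_mul (z : 𝕜) (k n : ℕ) :
    iteratedDeriv k (fun t : 𝕜 => t ^ n) z = k.factorial * ((n.choose k : 𝕜) * z ^ (n - k)) := by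
  rw [iteratedDeriv_pow, Nat.descFactorial_eq_factorial_mul_choose]
  push_cast
  ring

theorem matDeriv_Gtop_apply (r k : ℕ) (z : 𝕜) (i : Fin (r - k)) (j : Fin r) :
    ((k.factorial : 𝕜)⁻¹ • matDeriv k (Gtop r k) z) i j = quotCoeff z k i j := by
  have hk : (k.factorial : 𝕜) ≠ 0 := Nat.cast_ne_zero.mpr k.factorial_ne_zero
  simp only [Matrix.smul_apply, matDeriv, Gtop, G, of_apply, submatrix_apply, id_eq,
    Fin.val_castLE, smul_eq_mul, quotCoeff]
  split_ifs with h
  · rw [iteratedDeriv_pow_eq_factorial_mul, inv_mul_cancel_left₀ hk]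
  · simp

/-- Keeping only the first `r - k` rows loses nothing, because `k + 1` divisions lower the degree
enough; in the missing rows the binomial coefficients vanish. -/
theorem rowPoly_matDeriv_Gtop_mulVec (r k : ℕ) (z : 𝕜) (v : Fin r → 𝕜) :
    rowPoly (r - k) (((k.factorial : 𝕜)⁻¹ • matDeriv k (Gtop r k) z) *ᵥ v) =
      (divXSubC z ^ (k + 1)) (rowPoly r v) := by
  ext i
  rw [Module.End.pow_apply, divXSubC_iterate_rowPoly_coeff, rowPoly_coeff]
  split_ifs with h
  · simp only [mulVec, dotProduct, matDeriv_Gtop_apply]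
  · refine (Finset.sum_eq_zero fun j _ => ?_).symm
    unfold quotCoeff
    split_ifs
    · rw [Nat.choose_eq_zero_of_lt (by omega)]
      simp
    · simp

theorem rowPoly_G_mulVec (r : ℕ) (z : 𝕜) (v : Fin r → 𝕜) :
    rowPoly r (G r z *ᵥ v) = divXSubC z (rowPoly r v) := by
  ext i
  have := divXSubC_iterate_rowPoly_coeff z 0 i v
  rw [zero_add, Function.iterate_one] at this
  rw [this, rowPoly_coeff]
  split_ifs with h
  · simp only [mulVec, dotProduct, G, quotCoeff, of_apply, Nat.choose_zero_right, Nat.cast_one,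
      one_mul, Nat.sub_zero]
  · refine (Finset.sum_eq_zero fun j _ => ?_).symm
    rw [quotCoeff, if_neg (by omega), zero_mul]

/-- The normalisation `1 / (i! j!)` is the one for which `H i ∘ H j = (i + j).choose i • H (i + j)`
absorbs all factorials. -/
theorem calN_apply (q r μ ν : ℕ) (z : 𝕜) (a : Fin μ × Fin q) (b : Fin ν × Fin r) :
    calN q r μ ν z a b =
      (hasseDeriv (a.1 : ℕ) (hasseDeriv (b.1 : ℕ) (X ^ (a.2 : ℕ) * X ^ (b.2 : ℕ)))).eval z := by
  have h1 : ((a.1 : ℕ).factorial : 𝕜) ≠ 0 := Nat.cast_ne_zero.mpr (Nat.factorial_ne_zero _)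
  have h2 : ((b.1 : ℕ).factorial : 𝕜) ≠ 0 := Nat.cast_ne_zero.mpr (Nat.factorial_ne_zero _)
  have h3 : (((a.1 : ℕ) + (b.1 : ℕ)).choose (a.1 : ℕ) : 𝕜) * (a.1 : ℕ).factorial *
      (b.1 : ℕ).factorial = ((a.1 : ℕ) + (b.1 : ℕ)).factorial := by
    rw [← Nat.choose_symm_add.symm]
    exact_mod_cast Nat.add_choose_mul_factorial_mul_factorial (a.1 : ℕ) (b.1 : ℕ)
  rw [← LinearMap.comp_apply, hasseDeriv_comp, ← pow_add, LinearMap.smul_apply, eval_smul,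
    eval_hasseDeriv_X_pow]
  simp only [calN, matDeriv, M, u, w, of_apply, vecMulVec_apply, ← pow_add]
  rw [iteratedDeriv_pow_eq_factorial_mul, ← h3]
  rw [nsmul_eq_mul]
  field_simp

theorem calN_mulVec_apply (q r μ ν : ℕ) (z : 𝕜) (v : Fin ν × Fin r → 𝕜) (a : Fin μ × Fin q) :
    (calN q r μ ν z *ᵥ v) a = (hasseDeriv (a.1 : ℕ) (∑ j ∈ Finset.range ν,
      hasseDeriv j (X ^ (a.2 : ℕ) * blockPoly ν r j v))).eval z := by
  simp only [mulVec, dotProduct, Fintype.sum_prod_type, calN_apply, Finset.sum_range, map_sum,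
    eval_finsetSum]
  refine Finset.sum_congr rfl fun j _ => ?_
  rw [blockPoly_of_lt j.2, rowPoly_eq_sum, Finset.mul_sum]
  simp only [map_sum, mul_smul_comm, map_smul, eval_finsetSum, eval_smul, smul_eq_mul]
  exact Finset.sum_congr rfl fun i _ => mul_comm _ _

theorem mem_ker_calN_iff (q r μ ν : ℕ) (z : 𝕜) (v : Fin ν × Fin r → 𝕜) :
    v ∈ LinearMap.ker (calN q r μ ν z).mulVecLin ↔
      ∀ l < q, (X - C z) ^ μ ∣ hasseSum ν (fun j => blockPoly ν r j v) l := by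
  rw [← forall_dvd_sum_hasseDeriv_iff _ _ _ _ fun j hj => blockPoly_of_le hj v,
    LinearMap.mem_ker, mulVecLin_apply, funext_iff]
  simp only [X_sub_C_pow_dvd_iff_hasseDeriv, calN_mulVec_apply, Prod.forall, Pi.zero_apply]
  exact ⟨fun h a ha i hi => h ⟨i, hi⟩ ⟨a, ha⟩, fun h i a => h a a.2 i i.2⟩

end MatrixPart

end ConfluentVandermonde

namespace ConfluentVandermonde

open Polynomial Matrix

/-! ### Action of the factors on sequences, injectivity, and the dimension count. -/

section Kernel

variable {𝕜 : Type*} [RCLike 𝕜]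

theorem blockPoly_barK_mulVec_inl (q r ν k : ℕ) (z : 𝕜)
    (x : Fin q × Fin (r - (k + 1)) ⊕ Fin (ν - q) × Fin r → 𝕜) {j : ℕ} (hj : j < q) :
    blockPoly q (r - k) j ((barK q r ν k z *ᵥ x) ∘ Sum.inl) =
      (X - C z) * blockPoly q (r - (k + 1)) j (x ∘ Sum.inl) -
        blockPoly q (r - (k + 1)) (j + 1) (x ∘ Sum.inl) -
        if j + 1 = q then (divXSubC z ^ (k + 1)) (blockPoly (ν - q) r 0 (x ∘ Sum.inr)) else 0 := by
  rw [barK, fromBlocks_mulVec, Sum.elim_comp_inl, add_mulVec, neg_mulVec, map_add, map_add, map_neg,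
    blockPoly_one_kronecker_mulVec (L := LinearMap.mulLeft 𝕜 (X - C z)) (rowPoly_F_mulVec r k z),
    blockPoly_shift_kronecker_mulVec (L := -LinearMap.id) (rowPoly_matDeriv_F_mulVec r k z),
    blockPoly_corner_kronecker_mulVec (rowPoly_matDeriv_Gtop_mulVec r k z) hj]
  simp only [LinearMap.mulLeft_apply, LinearMap.neg_apply, LinearMap.id_apply]
  ring

theorem blockPoly_barK_mulVec_inr (q r ν k : ℕ) (z : 𝕜)
    (x : Fin q × Fin (r - (k + 1)) ⊕ Fin (ν - q) × Fin r → 𝕜) (j : ℕ) :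
    blockPoly (ν - q) r j ((barK q r ν k z *ᵥ x) ∘ Sum.inr) =
      blockPoly (ν - q) r j (x ∘ Sum.inr) -
        divXSubC z (blockPoly (ν - q) r (j + 1) (x ∘ Sum.inr)) := by
  rw [barK, fromBlocks_mulVec, Sum.elim_comp_inr, zero_mulVec, zero_add, sub_mulVec, map_sub,
    blockPoly_one_kronecker_mulVec (L := LinearMap.id) (fun v => by rw [one_mulVec]; rfl),
    blockPoly_shift_kronecker_mulVec (rowPoly_G_mulVec r z), LinearMap.id_apply]

theorem eq_zero_of_downward {A : Type*} [Zero A] {m : ℕ} {V : ℕ → A} (h0 : ∀ j, m ≤ j → V j = 0)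
    (h : ∀ j < m, V (j + 1) = 0 → V j = 0) (j : ℕ) : V j = 0 := by
  rcases le_total m j with hj | hj
  · exact h0 j hj
  · induction hj using Nat.decreasingInduction with
    | self => exact h0 m le_rfl
    | of_succ j hj ih => exact h j hj ih

/-- Back substitution from the last block: the lower part is unitriangular, and in the upper part
the diagonal operator is multiplication by `X - C z`. -/
theorem barK_mulVec_injective (q r ν k : ℕ) (z : 𝕜) :
    Function.Injective (barK q r ν k z).mulVecLin := by
  rw [← LinearMap.ker_eq_bot, LinearMap.ker_eq_bot']
  intro x hx
  rw [mulVecLin_apply] at hx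
  have hY : ∀ j, blockPoly (ν - q) r j (x ∘ Sum.inr) = 0 := by
    refine eq_zero_of_downward (fun j hj => blockPoly_of_le hj _) fun j _ h => ?_
    have := blockPoly_barK_mulVec_inr q r ν k z x j
    rw [hx, h, map_zero, sub_zero] at this
    rw [← this]
    exact map_zero _
  have hU : ∀ j, blockPoly q (r - (k + 1)) j (x ∘ Sum.inl) = 0 := by
    refine eq_zero_of_downward (fun j hj => blockPoly_of_le hj _) fun j hj h => ?_
    have := blockPoly_barK_mulVec_inl q r ν k z x hj
    rw [hx, h, hY, map_zero, ite_self, sub_zero, sub_zero] at this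
    exact (mul_eq_zero.mp (this.symm.trans (map_zero _))).resolve_left (X_sub_C_ne_zero z)
  rw [← Sum.elim_comp_inl_inr x, eq_zero_of_blockPoly_eq_zero fun j _ => hU j,
    eq_zero_of_blockPoly_eq_zero fun j _ => hY j]
  exact Sum.elim_zero_zero

theorem barCalK_mulVec_injective (q r ν i : ℕ) (z : 𝕜) :
    Function.Injective (barCalK q r ν i z).mulVecLin := by
  induction i with
  | zero => exact barK_mulVec_injective q r ν 0 z
  | succ i ih =>
    rw [barCalK, mulVecLin_mul, LinearMap.coe_comp]
    exact ih.comp (barK_mulVec_injective q r ν (i + 1) z)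

/-- The sequence of polynomials attached to `x`: the blocks of the first component, followed by
the blocks of the second one, each divided `k` times by `X - z`. -/
noncomputable def seqPoly {q n m r : ℕ} (z : 𝕜) (k : ℕ) (x : Fin q × Fin n ⊕ Fin m × Fin r → 𝕜)
    (j : ℕ) : 𝕜[X] :=
  if j < q then blockPoly q n j (x ∘ Sum.inl)
  else (divXSubC z ^ k) (blockPoly m r (j - q) (x ∘ Sum.inr))

theorem seqPoly_of_le {q n m r : ℕ} (z : 𝕜) (k : ℕ) (x : Fin q × Fin n ⊕ Fin m × Fin r → 𝕜)
    {j : ℕ} (hj : q + m ≤ j) : seqPoly z k x j = 0 := by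
  rw [seqPoly, if_neg (by omega), blockPoly_of_le (by omega), map_zero]

/-- Storing the blocks from `q` on undivided lets their sizes stay `r` for all factors; the price is
one remainder per step, the constant on the right. -/
theorem seqPoly_barK_mulVec (q r ν k : ℕ) (z : 𝕜)
    (x : Fin q × Fin (r - (k + 1)) ⊕ Fin (ν - q) × Fin r → 𝕜) (j : ℕ) :
    seqPoly z k (barK q r ν k z *ᵥ x) j =
      ((X - C z) * seqPoly z (k + 1) x j - seqPoly z (k + 1) x (j + 1)) +
        C (if j < q then 0
          else ((divXSubC z ^ k) (blockPoly (ν - q) r (j - q) (x ∘ Sum.inr))).eval z) := by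
  unfold seqPoly
  rcases lt_trichotomy (j + 1) q with h | h | h
  · have h' : j < q := by omega
    rw [if_pos h', if_pos h', if_pos h, if_pos h', blockPoly_barK_mulVec_inl q r ν k z x h',
      if_neg h.ne, sub_zero, C_0, add_zero]
  -- At the seam `j = q - 1` the successor lies in the second component, and the corner block
  -- supplies it, divided `k + 1` times.
  · have h' : j < q := by omega
    rw [if_pos h', if_pos h', if_neg h.not_lt, if_pos h', blockPoly_barK_mulVec_inl q r ν k z x h',
      if_pos h, blockPoly_of_le h.ge, sub_zero, C_0, add_zero, h, Nat.sub_self]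
  · have h' : ¬ j < q := by omega
    rw [if_neg h', if_neg h', if_neg (by omega), if_neg h', blockPoly_barK_mulVec_inr, map_sub,
      pow_succ', Module.End.mul_apply, X_sub_C_mul_divXSubC, show j + 1 - q = j - q + 1 by omega,
      ← pow_succ', pow_succ, Module.End.mul_apply]
    ring

theorem hasseSum_seqPoly_barK (q r ν k N : ℕ) (z : 𝕜) (hN : q + (ν - q) ≤ N)
    (x : Fin q × Fin (r - (k + 1)) ⊕ Fin (ν - q) × Fin r → 𝕜) {l : ℕ} (hl : l < q) :
    hasseSum N (seqPoly z k (barK q r ν k z *ᵥ x)) l =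
      (X - C z) * hasseSum N (seqPoly z (k + 1) x) l := by
  rw [funext (seqPoly_barK_mulVec q r ν k z x), hasseSum_add, hasseSum_C (K := 𝕜) N _ (if_pos hl),
    hasseSum_X_sub_C_mul_sub_shift z fun j hj => seqPoly_of_le z (k + 1) x (hN.trans hj), add_zero]

theorem hasseSum_seqPoly_barCalK (q r ν i N : ℕ) (z : 𝕜) (hN : q + (ν - q) ≤ N)
    (x : Fin q × Fin (r - (i + 1)) ⊕ Fin (ν - q) × Fin r → 𝕜) {l : ℕ} (hl : l < q) :
    hasseSum N (seqPoly z 0 (barCalK q r ν i z *ᵥ x)) l =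
      (X - C z) ^ (i + 1) * hasseSum N (seqPoly z (i + 1) x) l := by
  induction i with
  | zero =>
    exact (hasseSum_seqPoly_barK q r ν 0 N z hN x hl).trans
      (congrArg (· * _) (pow_one (X - C z)).symm)
  | succ i ih =>
    rw [barCalK, ← mulVec_mulVec, ih, hasseSum_seqPoly_barK q r ν (i + 1) N z hN x hl, ← mul_assoc,
      ← pow_succ]

theorem splitBlocks_symm_inl {m n : ℕ} (h : m ≤ n) (r : ℕ) (a : Fin m) (i : Fin r) :
    (splitBlocks h r).symm (Sum.inl (a, i)) = (⟨a, a.2.trans_le h⟩, i) := rfl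

theorem splitBlocks_symm_inr {m n : ℕ} (h : m ≤ n) (r : ℕ) (a : Fin (n - m)) (i : Fin r) :
    (splitBlocks h r).symm (Sum.inr (a, i)) = (⟨m + a, by omega⟩, i) := rfl

theorem blockPoly_comp_splitBlocks {m n : ℕ} (h : m ≤ n) (r j : ℕ)
    (y : Fin m × Fin r ⊕ Fin (n - m) × Fin r → 𝕜) :
    blockPoly n r j (y ∘ splitBlocks h r) =
      if j < m then blockPoly m r j (y ∘ Sum.inl) else blockPoly (n - m) r (j - m) (y ∘ Sum.inr) := by
  split_ifs with hj
  · rw [blockPoly_of_lt hj, blockPoly_of_lt (hj.trans_le h)]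
    congr 1
    ext i
    exact congrArg y ((Equiv.eq_symm_apply _).mp
      (splitBlocks_symm_inl h r ⟨j, hj⟩ i).symm)
  · rcases lt_or_ge j n with hn | hn
    · rw [blockPoly_of_lt hn, blockPoly_of_lt (by omega)]
      congr 1
      ext i
      refine congrArg y ((Equiv.eq_symm_apply _).mp ?_)
      rw [splitBlocks_symm_inr]
      exact Prod.ext (Fin.ext (by simp only; omega)) rfl
    · rw [blockPoly_of_le hn, blockPoly_of_le (by omega)]

theorem barCalKStar_mulVec (q r i : ℕ) (hr : 0 < r) (z : 𝕜)
    (x : Fin q × Fin (r - (i + 1)) ⊕ Fin (q + r - 1 - q) × Fin r → 𝕜) :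
    barCalKStar q r i hr z *ᵥ x =
      (barCalK q r (q + r - 1) i z *ᵥ x) ∘ splitBlocks (show q ≤ q + r - 1 by omega) r := rfl

theorem barBarCalK_mulVec (q r ν i : ℕ) (hr : 0 < r) (hν : q + r ≤ ν) (z : 𝕜)
    (x : (Fin q × Fin (r - (i + 1)) ⊕ Fin (q + r - 1 - q) × Fin r) ⊕
        Fin (ν - (q + r - 1)) × Fin r → 𝕜) :
    barBarCalK q r ν i hr hν z *ᵥ x =
      Sum.elim (barCalKStar q r i hr z *ᵥ (x ∘ Sum.inl)) (x ∘ Sum.inr) ∘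
        splitBlocks (show q + r - 1 ≤ ν by omega) r := by
  have : barBarCalK q r ν i hr hν z *ᵥ x = (fromBlocks (barCalKStar q r i hr z) 0 0 1 *ᵥ x) ∘
      splitBlocks (show q + r - 1 ≤ ν by omega) r := rfl
  rw [this, fromBlocks_mulVec, zero_mulVec, zero_mulVec, one_mulVec, add_zero, zero_add]

theorem barBarCalK_mulVec_injective (q r ν i : ℕ) (hr : 0 < r) (hν : q + r ≤ ν) (z : 𝕜) :
    Function.Injective (barBarCalK q r ν i hr hν z).mulVecLin := by
  rw [← LinearMap.ker_eq_bot, LinearMap.ker_eq_bot']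
  intro x hx
  rw [mulVecLin_apply, barBarCalK_mulVec, barCalKStar_mulVec] at hx
  have hx' := (Equiv.surjective _).injective_comp_right (hx.trans (Pi.zero_comp _).symm)
  have h1 := congrArg (· ∘ Sum.inl) hx'
  have h2 := congrArg (· ∘ Sum.inr) hx'
  simp only [Sum.elim_comp_inl, Sum.elim_comp_inr, Pi.zero_comp] at h1 h2
  have h3 := (Equiv.surjective _).injective_comp_right (h1.trans (Pi.zero_comp _).symm)
  have h4 : x ∘ Sum.inl = 0 :=
    barCalK_mulVec_injective q r (q + r - 1) i z (h3.trans (map_zero _).symm)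
  rw [← Sum.elim_comp_inl_inr x, h4, h2]
  exact Sum.elim_zero_zero

theorem blockPoly_barBarCalK_mulVec (q r ν i : ℕ) (hr : 0 < r) (hν : q + r ≤ ν) (z : 𝕜)
    (x : (Fin q × Fin (r - (i + 1)) ⊕ Fin (q + r - 1 - q) × Fin r) ⊕
        Fin (ν - (q + r - 1)) × Fin r → 𝕜) {j : ℕ} (hj : j < q + r - 1) :
    blockPoly ν r j (barBarCalK q r ν i hr hν z *ᵥ x) =
      seqPoly z 0 (barCalK q r (q + r - 1) i z *ᵥ (x ∘ Sum.inl)) j := by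
  rw [barBarCalK_mulVec, blockPoly_comp_splitBlocks, if_pos hj, Sum.elim_comp_inl,
    barCalKStar_mulVec, blockPoly_comp_splitBlocks]
  rfl

theorem hasseDeriv_blockPoly_of_le {n s j m : ℕ} (x : Fin n × Fin s → 𝕜) (h : s ≤ m) :
    hasseDeriv m (blockPoly n s j x) = 0 := by
  ext i
  rw [hasseDeriv_coeff, blockPoly_coeff_of_le (by omega), mul_zero, coeff_zero]

theorem range_barBarCalK_le_ker (q r ν i : ℕ) (hr : 0 < r) (hν : q + r ≤ ν) (z : 𝕜) :
    LinearMap.range (barBarCalK q r ν i hr hν z).mulVecLin ≤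
      LinearMap.ker (calN q r (i + 1) ν z).mulVecLin := by
  rintro _ ⟨x, rfl⟩
  rw [mulVecLin_apply, mem_ker_calN_iff]
  intro l hl
  have : hasseSum ν (fun j => blockPoly ν r j (barBarCalK q r ν i hr hν z *ᵥ x)) l =
      hasseSum ν (seqPoly z 0 (barCalK q r (q + r - 1) i z *ᵥ (x ∘ Sum.inl))) l := by
    refine Finset.sum_congr rfl fun m _ => ?_
    beta_reduce
    rcases lt_or_ge (l + m) (q + r - 1) with h | h
    · rw [blockPoly_barBarCalK_mulVec q r ν i hr hν z x h]
    -- Here `l ≤ q - 1` and `l + m ≥ q + r - 1` force `m ≥ r`, beyond the degree of every block.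
    · rw [hasseDeriv_blockPoly_of_le _ (by omega), seqPoly_of_le _ _ _ (by omega), map_zero]
  rw [this, hasseSum_seqPoly_barCalK q r (q + r - 1) i ν z (by omega) _ hl]
  exact dvd_mul_right _ _

theorem hasseSum_blockPoly_coeff_of_le {n s N l i : ℕ} (x : Fin n × Fin s → 𝕜) (h : s ≤ i) :
    (hasseSum N (fun j => blockPoly n s j x) l).coeff i = 0 := by
  rw [hasseSum, finsetSum_coeff]
  refine Finset.sum_eq_zero fun m _ => ?_
  rw [hasseDeriv_coeff, blockPoly_coeff_of_le (by omega), mul_zero]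

/-- The Hasse sum of the blocks of `x`, as a linear map. -/
noncomputable def hasseSumBlock (n s N l : ℕ) : (Fin n × Fin s → 𝕜) →ₗ[𝕜] 𝕜[X] :=
  ∑ m ∈ Finset.range N, hasseDeriv m ∘ₗ blockPoly n s (l + m)

theorem hasseSumBlock_apply (n s N l : ℕ) (x : Fin n × Fin s → 𝕜) :
    hasseSumBlock n s N l x = hasseSum N (fun j => blockPoly n s j x) l := by
  simp [hasseSumBlock, hasseSum]

theorem finrank_ker_calN_le (q r μ ν : ℕ) (hν : q + r ≤ ν) (hr : 0 < r) (z : 𝕜) :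
    Module.finrank 𝕜 (LinearMap.ker (calN q r μ ν z).mulVecLin) ≤
      q * (r - μ) + (ν - q) * r := by
  -- Coordinates that determine a kernel vector: Taylor coefficients at `z` of orders `μ, …, r - 1`
  -- of the first `q` Hasse sums, and the blocks from `q` on.
  let L : (Fin ν × Fin r → 𝕜) →ₗ[𝕜] (Fin q × Fin (r - μ) → 𝕜) × (Fin (ν - q) × Fin r → 𝕜) :=
    (LinearMap.pi fun p => lcoeff 𝕜 (μ + (p.2 : ℕ)) ∘ₗ (taylorAlgHom z).toLinearMap ∘ₗ
      hasseSumBlock ν r ν p.1).prod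
    (LinearMap.funLeft 𝕜 𝕜 fun p => (⟨q + (p.1 : ℕ), by omega⟩, p.2))
  have hL : Function.Injective (L.domRestrict (LinearMap.ker (calN q r μ ν z).mulVecLin)) := by
    rw [← LinearMap.ker_eq_bot, LinearMap.ker_eq_bot']
    rintro ⟨v, hv⟩ h
    rw [mem_ker_calN_iff] at hv
    obtain ⟨h1, h2⟩ := Prod.ext_iff.mp h
    have hV : ∀ j, q ≤ j → blockPoly ν r j v = 0 := by
      intro j hj
      rcases lt_or_ge j ν with hjν | hjν
      · rw [blockPoly_of_lt hjν, ← map_zero (rowPoly r)]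
        congr 1
        ext i
        have := congrFun h2 (⟨j - q, by omega⟩, i)
        simpa [L, LinearMap.funLeft_apply, Nat.add_sub_cancel' hj] using this
      · exact blockPoly_of_le hjν v
    have hW : ∀ l < q, hasseSum ν (fun j => blockPoly ν r j v) l = 0 := by
      intro l hl
      apply taylor_injective z
      rw [map_zero]
      ext i
      rw [coeff_zero]
      -- Taylor coefficients below `μ` vanish by the kernel condition, those in `[μ, r)` by the
      -- choice of `L`, and the rest by degree.
      rcases lt_or_ge i μ with hi | hi
      · rw [taylor_coeff]
        exact (X_sub_C_pow_dvd_iff_hasseDeriv z μ _).mp (hv l hl) i hi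
      rcases lt_or_ge i r with hir | hir
      · have := congrFun h1 (⟨l, hl⟩, ⟨i - μ, by omega⟩)
        simpa [L, hasseSumBlock_apply, Nat.add_sub_cancel' hi] using this
      · rw [taylor_coeff]
        have : hasseDeriv i (hasseSum ν (fun j => blockPoly ν r j v) l) = 0 := by
          ext n
          rw [hasseDeriv_coeff, hasseSum_blockPoly_coeff_of_le v (by omega), mul_zero, coeff_zero]
        rw [this, eval_zero]
    exact Subtype.ext (eq_zero_of_blockPoly_eq_zero fun j _ =>
      eq_zero_of_hasseSum_eq_zero (by omega) hV hW j)
  have := LinearMap.finrank_le_finrank_of_injective hL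
  simpa [Module.finrank_prod, Module.finrank_fintype_fun_eq_card] using this

theorem finrank_range_barBarCalK (q r ν i : ℕ) (hr : 0 < r) (hν : q + r ≤ ν) (z : 𝕜) :
    Module.finrank 𝕜 (LinearMap.range (barBarCalK q r ν i hr hν z).mulVecLin) =
      q * (r - (i + 1)) + (ν - q) * r := by
  rw [LinearMap.finrank_range_of_inj (barBarCalK_mulVec_injective q r ν i hr hν z),
    Module.finrank_fintype_fun_eq_card]
  simp only [Fintype.card_sum, Fintype.card_prod, Fintype.card_fin]
  rw [add_assoc, ← add_mul, show q + r - 1 - q + (ν - (q + r - 1)) = ν - q by omega]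

theorem ker_calN_eq_range (q r ν i : ℕ) (hr : 0 < r) (hν : q + r ≤ ν) (z : 𝕜) :
    LinearMap.ker (calN q r (i + 1) ν z).mulVecLin =
      LinearMap.range (barBarCalK q r ν i hr hν z).mulVecLin :=
  (Submodule.eq_of_le_of_finrank_le (range_barBarCalK_le_ker q r ν i hr hν z)
    ((finrank_ker_calN_le q r (i + 1) ν hν hr z).trans
      (finrank_range_barBarCalK q r ν i hr hν z).ge)).symm

end Kernel

end ConfluentVandermonde

theorem mainTheorem12 {𝕜 : Type*} [RCLike 𝕜] (q r μ ν : ℕ) (hq : 0 < q) (hr : 0 < r)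
    (hμ : 0 < μ) (hν : q + r ≤ ν) (z : 𝕜) :
    LinearMap.ker (ConfluentVandermonde.calN q r μ ν z).mulVecLin =
        Submodule.span 𝕜
          (Set.range (ConfluentVandermonde.barBarCalK q r ν (μ - 1) hr hν z).col) ∧
      (μ < r →
        Module.finrank 𝕜 (LinearMap.ker (ConfluentVandermonde.calN q r μ ν z).mulVecLin) =
          ν * r - μ * q) ∧
      (r ≤ μ →
        Module.finrank 𝕜 (LinearMap.ker (ConfluentVandermonde.calN q r μ ν z).mulVecLin) =
          (ν - q) * r) ∧
      Module.finrank 𝕜 (LinearMap.ker (ConfluentVandermonde.calN q r μ ν z).mulVecLin) =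
        ν * r - q * min μ r := by
  obtain ⟨i, rfl⟩ : ∃ i, μ = i + 1 := ⟨μ - 1, by omega⟩
  have hdim : Module.finrank 𝕜
      (LinearMap.ker (ConfluentVandermonde.calN q r (i + 1) ν z).mulVecLin) =
      q * (r - (i + 1)) + (ν - q) * r := by
    rw [ConfluentVandermonde.ker_calN_eq_range q r ν i hr hν z,
      ConfluentVandermonde.finrank_range_barBarCalK]
  have hlt : i + 1 ≤ r → q * (r - (i + 1)) + (ν - q) * r = ν * r - (i + 1) * q := by
    intro h
    obtain ⟨d, rfl⟩ := Nat.exists_eq_add_of_le h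
    obtain ⟨e, rfl⟩ := Nat.exists_eq_add_of_le (show q ≤ ν by omega)
    rw [Nat.add_sub_cancel_left, Nat.add_sub_cancel_left]
    refine (Nat.sub_eq_of_eq_add ?_).symm
    ring
  have hge : r ≤ i + 1 → q * (r - (i + 1)) + (ν - q) * r = (ν - q) * r := by
    intro h
    rw [Nat.sub_eq_zero_of_le h, mul_zero, zero_add]
  rw [hdim]
  refine ⟨?_, fun h => hlt h.le, hge, ?_⟩
  · rw [ConfluentVandermonde.ker_calN_eq_range q r ν i hr hν z, Matrix.range_mulVecLin]
    rfl
  · rcases le_total (i + 1) r with h | h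
    · rw [min_eq_left h, hlt h, mul_comm q]
    · rw [min_eq_right h, hge h, Nat.sub_mul]
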